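/- Let $S$ be a countably infinite set and let $k\ge 0$ be an integer. Write $\binom{S}{k}$ for the set of $k$-element subsets of $S$, and, for any set $V$, write $\binom{V}{<k}$ for the set of subsets of $V$ (including the empty set, if $k\ge1$) with fewer than $k$ elements; thus $\binom{[k]}{<k}$, where $[k]=\{1,\dots,k\}$, is the set of the $2^k-1$ proper subsets of $[k]$. Let $\mu$ be an exchangeable random $\{0,1\}$-coloured $k$-uniform hypergraph on $S$, i.e. a probability measure on the product space $\{0,1\}^{\binom{S}{k}}$ that is invariant under the maps $(\omega_e)_{e}\mapsto(\omega_{g(e)})_{e}$ for all finitely supported permutations $g$ of $S$. Then there is a Borel measurable function $$W:[0,1]^{\binom{[k]}{<k}}=[0,1]^{2^k-1}\to[0,1],$$ symmetric under the coordinate permutations induced by $\mathrm{Sym}([k])$, such that for every finite $k$-uniform hypergraph $(V,F)$ with $V\subset S$ finite and $F\subseteq\binom{V}{k}$, $$\mu\Big(\big\{\omega\in\{0,1\}^{\binom{S}{k}}:\ \omega_e=1\ \text{for all } e\in F\big\}\Big)=\int_{[0,1]^{\binom{V}{<k}}}\ \prod_{e\in F}W\big(x|_{\binom{e}{<k}}\big)\,dx,$$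 where $dx$ is Lebesgue measure on the cube $[0,1]^{\binom{V}{<k}}$. Here $x|_{\binom{e}{<k}}=(x_a)_{a\subsetneq e}$ is regarded as a point of $[0,1]^{\binom{[k]}{<k}}$ by means of any bijection $[k]\to e$; by the symmetry of $W$ the choice of bijection does not matter. -/

import Mathlib

open MeasureTheory

/-- The set `binom(S, k)` of all `k`-element subsets ("`k`-hyperedges") of `S`. -/
abbrev HyperEdge (S : Type*) (k : ℕ) : Type _ := {e : Finset S // e.card = k}

/-- The set `binom(S, <k)` of all subsets of `S` with fewer than `k` elements (the empty set
is one of them when `0 < k`). For `S = Fin k` these are the `2 ^ k - 1` proper subsets. -/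
abbrev LowerEdge (S : Type*) (k : ℕ) : Type _ := {a : Finset S // a.card < k}

/-- The image `f(e)` of a `k`-hyperedge `e` under an injection `f` of vertex sets. -/
def HyperEdge.image {S T : Type*} {k : ℕ} (f : S ↪ T) (e : HyperEdge S k) : HyperEdge T k :=
  ⟨e.1.map f, (Finset.card_map f).trans e.2⟩

/-- The image `f(a)` of a set `a` with fewer than `k` elements under an injection `f`. -/
def LowerEdge.image {S T : Type*} {k : ℕ} (f : S ↪ T) (a : LowerEdge S k) : LowerEdge T k :=
  ⟨a.1.map f, lt_of_eq_of_lt (Finset.card_map f) a.2⟩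

/-- `K`-coloured `k`-uniform hypergraphs on `S`, i.e. points of the product `K ^ binom(S, k)`;
this type carries the product measurable structure. -/
abbrev ColouredHypergraph (K S : Type*) (k : ℕ) : Type _ := HyperEdge S k → K

/-- The coordinate-permuting action `(ω_e)_e ↦ (ω_{g(e)})_e` of a permutation of `S`. -/
def permuteColours {K S : Type*} {k : ℕ} (g : Equiv.Perm S) (ω : ColouredHypergraph K S k) :
    ColouredHypergraph K S k :=
  fun e => ω (e.image g.toEmbedding)

/-- The law `μ` of a random `K`-coloured `k`-uniform hypergraph on `S` is exchangeable if it is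
invariant under all finitely supported permutations of the vertex set. -/
def IsExchangeableLaw {K S : Type*} [MeasurableSpace K] {k : ℕ}
    (μ : Measure (ColouredHypergraph K S k)) : Prop :=
  ∀ g : Equiv.Perm S, {s | g s ≠ s}.Finite → μ.map (permuteColours g) = μ

/-- A listing `φ` of the `k` elements of a hyperedge `e`, as an injection of `{0, …, k - 1}`
into the vertex set. -/
def HyperEdge.listing {S : Type*} {k : ℕ} (e : HyperEdge S k) (φ : Fin k ≃ e.1) : Fin k ↪ S :=
  φ.toEmbedding.trans (Function.Embedding.subtype _)

/-- The pullback of a family `(x_a)`, indexed by the subsets `a` of `T` with fewer than `k`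
elements, along an injection `f : S ↪ T`. If `S = Fin k` and `f` lists a hyperedge `e` this is
the restriction of `x` to the proper subsets of `e`, read as a point of a product indexed by the
proper subsets of `Fin k`. -/
def pullbackLower {S T X : Type*} {k : ℕ} (f : S ↪ T) (x : LowerEdge T k → X) :
    LowerEdge S k → X :=
  fun a => x (a.image f)

/-- The cylinder set of all `{0,1}`-coloured `k`-uniform hypergraphs `ω` on `S` whose restriction
to the `k`-subsets of `V` is at least the indicator of `F`: all edges of the finite hypergraph
`(V, F)` are present in `ω`. -/
def containsHypergraph {S : Type*} {k : ℕ} (V : Finset S) (F : Finset (HyperEdge V k)) :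
    Set (ColouredHypergraph (Fin 2) S k) :=
  {ω | ∀ e ∈ F, ω (e.image (Function.Embedding.subtype _)) = 1}

open ProbabilityTheory

/-! This is an Aldous–Hoover representation, proved with a reservoir of spare vertices. The law `μ`
is transported to the vertex set `S ⊕ ℕ`, where exchangeability becomes invariance under all
injections of the vertex set into itself. The profile of a finite `a ⊆ S` is the family of values at
all `a ∪ c`, with `c` a finite subset of the reservoir `ℕ`; for a `k`-set, the entry at `c = ∅` is
the colour of the edge itself.

The crux, `measure_inter`, is a conditional independence: given the profiles of all sets not
containing `a`, the conditional law of the profile of `a` depends only on the profiles of the proper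
subsets of `a`. Consider an event involving finitely many entries of the profile of `a`. An
injection that fixes `a` and the reservoir points involved, and sends all other points into the
reservoir, turns each set not containing `a` into a proper subset of `a` together with reservoir
points. It preserves the law and the event, so conditioning on the pulled-back σ-algebra yields the
same variance as conditioning on the large one. Equal variances force equal conditional expectations
(`condExp_eq_of_comap_le`).

Profiles can therefore be generated by increasing cardinality, each from those of the proper subsets
and one fresh uniform seed, by a rule invariant under relabelling (`exists_symmetric_draw`);
`map_maskTo_eq` identifies the resulting law. The function `W` is the probability that the profile
drawn at a `k`-set has entry `1` at `∅`, as a function of the seeds below. Integrating out the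
independent seeds at the edges gives the product. -/

/-! ### From finitely supported permutations to injections. -/

theorem exists_perm_eqOn_finset {S : Type*} (U : Finset S) (g : S ↪ S) :
    ∃ σ : Equiv.Perm S, {s | σ s ≠ s}.Finite ∧ ∀ u ∈ U, σ u = g u := by
  classical
  let A : Finset S := U ∪ U.map g
  -- A bijection between two subsets of the finite set `A` extends to a permutation of `A`.
  let e : {x : A // x.1 ∈ U} ≃ {x : A // x.1 ∈ U.map g} :=
    { toFun := fun x => ⟨⟨g x.1.1, Finset.mem_union_right _ (Finset.mem_map_of_mem g x.2)⟩,
        Finset.mem_map_of_mem g x.2⟩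
      invFun := fun y => ⟨⟨(Finset.mem_map.1 y.2).choose,
          Finset.mem_union_left _ (Finset.mem_map.1 y.2).choose_spec.1⟩,
        (Finset.mem_map.1 y.2).choose_spec.1⟩
      left_inv := by
        intro x
        apply Subtype.ext
        apply Subtype.ext
        apply g.injective
        exact (Finset.mem_map.1 (Finset.mem_map_of_mem g x.2)).choose_spec.2
      right_inv := by
        intro y
        apply Subtype.ext
        apply Subtype.ext
        exact (Finset.mem_map.1 y.2).choose_spec.2 }
  refine ⟨Equiv.Perm.ofSubtype (p := fun x => x ∈ A) e.extendSubtype, ?_, ?_⟩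
  · refine A.finite_toSet.subset fun s hs => ?_
    by_contra h
    exact hs (Equiv.Perm.ofSubtype_apply_of_not_mem _ h)
  · intro u hu
    have huA : u ∈ A := Finset.mem_union_left _ hu
    rw [Equiv.Perm.ofSubtype_apply_of_mem _ huA,
      e.extendSubtype_apply_of_mem ⟨u, huA⟩ hu]
    rfl

theorem MeasureTheory.Measure.ext_of_map_finset_restrict {ι : Type*} {X : ι → Type*}
    [∀ i, MeasurableSpace (X i)] {μ ν : Measure (∀ i, X i)} [IsFiniteMeasure μ]
    (h : ∀ I : Finset ι, μ.map I.restrict = ν.map I.restrict) : μ = ν := by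
  have : ∀ I : Finset ι, IsFiniteMeasure (μ.map I.restrict) := fun I => inferInstance
  exact IsProjectiveLimit.unique (P := fun I => μ.map I.restrict) (fun I => rfl)
    (fun I => (h I).symm)

theorem measurable_image_pullback {K S T : Type*} [MeasurableSpace K] {k : ℕ} (g : S ↪ T) :
    Measurable (fun (ω : ColouredHypergraph K T k) (e : HyperEdge S k) => ω (e.image g)) :=
  measurable_pi_lambda _ fun _ => measurable_pi_apply _

/-- An exchangeable law is invariant under all injections of the vertex set into itself. -/
theorem IsExchangeableLaw.map_embedding {K S : Type*} [MeasurableSpace K] {k : ℕ}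
    {μ : Measure (ColouredHypergraph K S k)} [IsFiniteMeasure μ] (hμ : IsExchangeableLaw μ)
    (g : S ↪ S) : μ.map (fun ω e => ω (e.image g)) = μ := by
  classical
  apply Measure.ext_of_map_finset_restrict
  intro I
  obtain ⟨σ, hσ, hσg⟩ := exists_perm_eqOn_finset (I.biUnion fun e => e.1) g
  conv_rhs => rw [← hμ σ hσ]
  have h₁ : Measurable (permuteColours σ : ColouredHypergraph K S k → _) :=
    measurable_image_pullback σ.toEmbedding
  rw [Measure.map_map (Finset.measurable_restrict I) (measurable_image_pullback g),
    Measure.map_map (Finset.measurable_restrict I) h₁]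
  congr 1
  funext ω e
  simp only [Function.comp_apply, Finset.restrict, permuteColours]
  congr 1
  apply Subtype.ext
  simp only [HyperEdge.image, Finset.map_eq_image]
  refine Finset.image_congr fun v hv => ?_
  exact (hσg v (Finset.mem_biUnion.2 ⟨e.1, e.2, hv⟩)).symm

/-! ### Conditional expectations under measure-preserving maps. -/

theorem condExp_comp_measurePreserving {Ω : Type*} {m m₀ : MeasurableSpace Ω} {P : Measure Ω}
    [IsFiniteMeasure P] (hm : m ≤ m₀) {θ : Ω → Ω} (hθ : MeasurePreserving θ P P)
    {ξ : Ω → ℝ} (hξ : Integrable ξ P) :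
    P[ξ | m] ∘ θ =ᵐ[P] P[ξ ∘ θ | m.comap θ] := by
  have hle : m.comap θ ≤ m₀ := (MeasurableSpace.comap_mono hm).trans hθ.measurable.comap_le
  refine ae_eq_condExp_of_forall_setIntegral_eq hle (hθ.integrable_comp_of_integrable hξ)
    (fun s _ _ => (hθ.integrable_comp_of_integrable integrable_condExp).integrableOn) ?_
    (stronglyMeasurable_condExp.comp_measurable
      (comap_measurable θ)).aestronglyMeasurable
  rintro _ ⟨s, hs, rfl⟩ -
  have key : ∀ f : Ω → ℝ, Integrable f P →
      ∫ x in θ ⁻¹' s, (f ∘ θ) x ∂P = ∫ x in s, f x ∂P := by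
    intro f hf
    conv_rhs => rw [← hθ.map_eq]
    rw [setIntegral_map (hm s hs) (by rw [hθ.map_eq]; exact hf.aestronglyMeasurable)
      hθ.measurable.aemeasurable]
    rfl
  rw [key _ integrable_condExp, key _ hξ, setIntegral_condExp hm hξ hs]

/-- A square-integrable function whose conditional expectation has the same variance agrees with
its conditional expectation. -/
theorem ae_eq_condExp_of_variance_eq {Ω : Type*} {m m₀ : MeasurableSpace Ω} {P : Measure Ω}
    [IsProbabilityMeasure P] (hm : m ≤ m₀) {f : Ω → ℝ} (hf : MemLp f 2 P)
    (h : Var[P[f | m]; P] = Var[f; P]) : f =ᵐ[P] P[f | m] := by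
  have h₁ := integral_condVar_add_variance_condExp hm hf
  have hint : Integrable ((f - P[f | m]) ^ 2) P :=
    (hf.sub (hf.condExp one_le_two)).integrable_sq
  have h₂ := setIntegral_condVar (hm := hm) hint MeasurableSet.univ
  simp only [setIntegral_univ] at h₂
  -- By the law of total variance, the expected conditional variance vanishes.
  have h₃ : ∫ ω, (f ω - (P[f | m]) ω) ^ 2 ∂P = 0 := by linarith
  filter_upwards [(integral_eq_zero_iff_of_nonneg (fun ω => sq_nonneg _) hint).1 h₃] with ω hω
  have : (f ω - (P[f | m]) ω) ^ 2 = 0 := hω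
  nlinarith [pow_eq_zero_iff (two_ne_zero) |>.1 this]

/-- If a measure-preserving map `θ` fixes `ξ` and pulls the larger σ-algebra back into the smaller
one, then both σ-algebras give the same conditional expectation of `ξ`. -/
theorem condExp_eq_of_comap_le {Ω : Type*} {m₁ m₂ m₀ : MeasurableSpace Ω} {P : Measure Ω}
    [IsProbabilityMeasure P] (h₁₂ : m₁ ≤ m₂) (hm₂ : m₂ ≤ m₀) {θ : Ω → Ω}
    (hθ : MeasurePreserving θ P P) (hcomap : m₂.comap θ ≤ m₁) {ξ : Ω → ℝ} (hξ : MemLp ξ 2 P)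
    (hξθ : ξ ∘ θ = ξ) : P[ξ | m₂] =ᵐ[P] P[ξ | m₁] := by
  have hm₁ : m₁ ≤ m₀ := h₁₂.trans hm₂
  have hint := hξ.integrable one_le_two
  have h₁ := condExp_comp_measurePreserving hm₂ hθ hint
  rw [hξθ] at h₁
  have h₂ : P[P[ξ | m₂] | m₂.comap θ] =ᵐ[P] P[ξ | m₂.comap θ] :=
    condExp_condExp_of_le (hcomap.trans h₁₂) hm₂
  -- Conditioning on `m₂.comap θ` gives `P[ξ | m₂] ∘ θ`, which is distributed as `P[ξ | m₂]`.
  have hvar : Var[P[P[ξ | m₂] | m₂.comap θ]; P] = Var[P[ξ | m₂]; P] := by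
    rw [variance_congr (h₂.trans h₁.symm)]
    have : AEMeasurable (P[ξ | m₂]) (P.map θ) := by
      rw [hθ.map_eq]; exact integrable_condExp.aemeasurable
    rw [← variance_map this hθ.measurable.aemeasurable, hθ.map_eq]
  have h₃ := (ae_eq_condExp_of_variance_eq (hcomap.trans hm₁) (hξ.condExp one_le_two) hvar).trans h₂
  have h₄ : P[P[ξ | m₂] | m₁] =ᵐ[P] P[ξ | m₁] := condExp_condExp_of_le h₁₂ hm₂
  have h₅ : P[P[ξ | m₂.comap θ] | m₁] = P[ξ | m₂.comap θ] :=
    condExp_of_stronglyMeasurable hm₁ (stronglyMeasurable_condExp.mono hcomap) integrable_condExp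
  refine h₃.trans ?_
  rw [← h₅]
  exact (condExp_congr_ae h₃).symm.trans h₄

/-! ### Arrays indexed by finite sets, and their profiles. -/

/-- The pullback of an array indexed by finite sets along an injection of vertex sets. -/
def relabel {S T K : Type*} (g : S ↪ T) (ω : Finset T → K) : Finset S → K :=
  fun a => ω (a.map g)

/-- Invariance of the law of an array under all injections of the vertex set into itself. -/
def IsInjectionInvariant {T K : Type*} [MeasurableSpace K] (P : Measure (Finset T → K)) : Prop :=
  ∀ g : T ↪ T, P.map (relabel g) = P

/-- The part of an array on `S ⊕ ℕ` seen by a finite set `a` of `S`, with all possible companions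
in the reservoir `ℕ`. -/
def profile {S K : Type*} (ω : Finset (S ⊕ ℕ) → K) : Finset S → Finset ℕ → K :=
  fun a c => ω (a.disjSum c)

/-- The values of `m` at the images of the proper subsets of `Fin j`. -/
def properPart {U Z : Type*} [Inhabited Z] {j : ℕ} (φ : Fin j ↪ U) (m : Finset U → Z) :
    Finset (Fin j) → Z :=
  -- The default at `univ` hides the value at the full set, which is the one to be drawn.
  fun b => if b = Finset.univ then default else m (b.map φ)

theorem measurable_relabel {S T K : Type*} [MeasurableSpace K] (g : S ↪ T) :
    Measurable (relabel g : (Finset T → K) → Finset S → K) :=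
  measurable_pi_lambda _ fun _ => measurable_pi_apply _

theorem measurable_profile {S K : Type*} [MeasurableSpace K] :
    Measurable (profile : (Finset (S ⊕ ℕ) → K) → Finset S → Finset ℕ → K) :=
  measurable_pi_lambda _ fun _ => measurable_pi_lambda _ fun _ => measurable_pi_apply _

theorem measurable_properPart {U Z : Type*} [MeasurableSpace Z] [Inhabited Z] {j : ℕ}
    (φ : Fin j ↪ U) : Measurable (properPart φ : (Finset U → Z) → _) := by
  refine measurable_pi_lambda _ fun b => ?_
  by_cases hb : b = Finset.univ
  · simp only [properPart, hb, if_true]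
    exact measurable_const
  · simp only [properPart, hb, if_false]
    exact measurable_pi_apply _

theorem relabel_relabel {S T U K : Type*} (f : S ↪ T) (g : T ↪ U) (ω : Finset U → K) :
    relabel f (relabel g ω) = relabel (f.trans g) ω := by
  funext a
  simp [relabel, Finset.map_map]

theorem profile_relabel {S K : Type*} (g : S ↪ S) (ω : Finset (S ⊕ ℕ) → K) :
    profile (relabel (g.sumMap (Function.Embedding.refl ℕ)) ω) = relabel g (profile ω) := by
  funext a c
  simp only [profile, relabel]
  congr 1
  ext x
  rcases x with x | x <;> simp [Finset.mem_disjSum]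

theorem properPart_relabel {U V Z : Type*} [Inhabited Z] {j : ℕ} (φ : Fin j ↪ U) (g : U ↪ V)
    (m : Finset V → Z) : properPart φ (relabel g m) = properPart (φ.trans g) m := by
  funext b
  simp [properPart, relabel, Finset.map_map]

theorem relabel_properPart {U Z : Type*} [Inhabited Z] {j : ℕ} (φ : Fin j ↪ U)
    (σ : Equiv.Perm (Fin j)) (m : Finset U → Z) :
    relabel σ.toEmbedding (properPart φ m) = properPart (σ.toEmbedding.trans φ) m := by
  funext b
  have : b.map σ.toEmbedding = Finset.univ ↔ b = Finset.univ := by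
    rw [← Finset.card_eq_iff_eq_univ, Finset.card_map, Finset.card_eq_iff_eq_univ]
  simp [properPart, relabel, Finset.map_map, this]

/-! ### Symmetric disintegrations and samplers. -/

/-- A permutation-invariant disintegration, realised by a sampling function. -/
theorem exists_symmetric_draw {Z : Type*} [MeasurableSpace Z] [StandardBorelSpace Z] [Nonempty Z]
    {j : ℕ} (ρ : Measure ((Finset (Fin j) → Z) × Z)) [IsProbabilityMeasure ρ]
    (hρ : ∀ σ : Equiv.Perm (Fin j), ρ.map (Prod.map (relabel σ.toEmbedding) id) = ρ) :
    ∃ G : (Finset (Fin j) → Z) → unitInterval → Z, Measurable (Function.uncurry G) ∧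
      (∀ (σ : Equiv.Perm (Fin j)) (z), G (relabel σ.toEmbedding z) = G z) ∧
      ∀ t s, MeasurableSet t → MeasurableSet s →
        ρ (t ×ˢ s) = ∫⁻ z in t, volume (G z ⁻¹' s) ∂ρ.fst := by
  let N : ENNReal := Fintype.card (Equiv.Perm (Fin j))
  have hN0 : N ≠ 0 := by simp [N]
  have hNtop : N ≠ ⊤ := ENNReal.natCast_ne_top _
  -- Each relabelled kernel also disintegrates `ρ`; averaging makes the invariance hold everywhere,
  -- not just almost everywhere.
  let κ : (Finset (Fin j) → Z) → Measure Z := fun z =>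
    N⁻¹ • ∑ σ : Equiv.Perm (Fin j), ρ.condKernel (relabel σ.toEmbedding z)
  have κ_apply : ∀ z s, κ z s =
      N⁻¹ * ∑ σ : Equiv.Perm (Fin j), ρ.condKernel (relabel σ.toEmbedding z) s := by
    intro z s
    simp [κ, Measure.finsetSum_apply]
  have hmeas : ∀ (σ : Equiv.Perm (Fin j)) (s : Set Z), MeasurableSet s →
      Measurable fun z => ρ.condKernel (relabel σ.toEmbedding z) s := fun σ s hs =>
    (Kernel.measurable_coe _ hs).comp (measurable_relabel _)
  have κ_meas : Measurable κ := by
    refine Measure.measurable_of_measurable_coe _ fun s hs => ?_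
    simp only [κ_apply]
    exact (Finset.measurable_sum _ fun σ _ => hmeas σ s hs).const_mul _
  have κ_prob : ∀ z, IsProbabilityMeasure (κ z) := by
    intro z
    refine ⟨?_⟩
    rw [κ_apply]
    simp only [measure_univ, Finset.sum_const, Finset.card_univ, nsmul_eq_mul, mul_one]
    exact ENNReal.inv_mul_cancel hN0 hNtop
  have κ_symm : ∀ (σ : Equiv.Perm (Fin j)) z, κ (relabel σ.toEmbedding z) = κ z := by
    intro σ z
    simp only [κ, relabel_relabel]
    congr 1
    refine Fintype.sum_equiv (Equiv.mulLeft σ) _ _ fun τ => ?_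
    rfl
  have κ_disint : ∀ t s, MeasurableSet t → MeasurableSet s →
      ρ (t ×ˢ s) = ∫⁻ z in t, κ z s ∂ρ.fst := by
    intro t s ht hs
    have hσ : ∀ σ : Equiv.Perm (Fin j),
        ∫⁻ z in t, ρ.condKernel (relabel σ.toEmbedding z) s ∂ρ.fst = ρ (t ×ˢ s) := by
      intro σ
      have hr := measurable_relabel (K := Z) σ.toEmbedding
      have hfst : ρ.fst.map (relabel σ.toEmbedding) = ρ.fst := by
        conv_rhs => rw [← hρ σ]
        simp only [Measure.fst]
        rw [Measure.map_map hr measurable_fst,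
          Measure.map_map measurable_fst (hr.prodMap measurable_id)]
        rfl
      have hinv : ∀ z : Finset (Fin j) → Z,
          relabel (σ⁻¹ : Equiv.Perm (Fin j)).toEmbedding (relabel σ.toEmbedding z) = z := by
        intro z
        rw [relabel_relabel]
        funext b
        simp only [relabel]
        congr 1
        ext x
        simp
      let t' := relabel (K := Z) (σ⁻¹ : Equiv.Perm (Fin j)).toEmbedding ⁻¹' t
      have ht' : MeasurableSet t' := measurable_relabel _ ht
      have htt' : relabel σ.toEmbedding ⁻¹' t' = t := by
        ext z
        simp only [t', Set.mem_preimage, hinv]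
      rw [← htt', ← setLIntegral_map ht' (Kernel.measurable_coe _ hs) hr, hfst,
        ← Measure.compProd_apply_prod ht' hs, ρ.disintegrate, htt']
      conv_lhs => rw [← hρ σ]
      rw [Measure.map_apply (hr.prodMap measurable_id) (ht'.prod hs)]
      congr 1
      ext ⟨z, y⟩
      simp [t', hinv]
    simp only [κ_apply]
    rw [lintegral_const_mul _ (Finset.measurable_sum _ fun σ _ => hmeas σ s hs),
      lintegral_finsetSum _ fun σ _ => hmeas σ s hs]
    simp only [hσ, Finset.sum_const, Finset.card_univ, nsmul_eq_mul]
    rw [← mul_assoc, ENNReal.inv_mul_cancel hN0 hNtop, one_mul]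
  -- Sampling is parametrised by the measure itself, so the sampling function inherits the
  -- invariance of `κ`.
  let ι : Kernel {m : Measure Z // IsProbabilityMeasure m} Z := ⟨Subtype.val, measurable_subtype_coe⟩
  have : IsMarkovKernel ι := ⟨fun m => m.2⟩
  obtain ⟨f, hf, hfι⟩ := ι.exists_measurable_map_eq_unitInterval
  refine ⟨fun z => f ⟨κ z, κ_prob z⟩, ?_, fun σ z => ?_, fun t s ht hs => ?_⟩
  · exact hf.comp ((κ_meas.subtype_mk.comp measurable_fst).prodMk measurable_snd)
  · simp only [κ_symm]
  · rw [κ_disint t s ht hs]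
    congr 1
    funext z
    rw [← Measure.map_apply (hf.of_uncurry_left) hs, hfι]
    rfl

/-- A family of permutation-invariant functions which draw the value at a `j`-set from the values
at its proper subsets and a uniform random seed. -/
structure SymmetricSampler (Z : Type*) [MeasurableSpace Z] where
  /-- The value drawn from the values at proper subsets and a seed. -/
  draw : ∀ {j : ℕ}, (Finset (Fin j) → Z) → unitInterval → Z
  measurable_draw : ∀ j : ℕ, Measurable (Function.uncurry (draw (j := j)))
  draw_relabel : ∀ {j : ℕ} (σ : Equiv.Perm (Fin j)) (z : Finset (Fin j) → Z),
    draw (relabel σ.toEmbedding z) = draw z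

theorem SymmetricSampler.measurable_volume_draw {Z : Type*} [MeasurableSpace Z]
    (G : SymmetricSampler Z) (j : ℕ) {s : Set Z} (hs : MeasurableSet s) :
    Measurable fun z : Finset (Fin j) → Z => (volume (G.draw z ⁻¹' s) : ENNReal) :=
  measurable_measure_prodMk_left (G.measurable_draw j hs)

/-- The sampler realises the conditional law of the profile of a set given the profiles of its
proper subsets. -/
def SymmetricSampler.Represents {S K : Type*} [MeasurableSpace K] [Inhabited K]
    (G : SymmetricSampler (Finset ℕ → K)) (P : Measure (Finset (S ⊕ ℕ) → K)) : Prop :=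
  ∀ (j : ℕ) (φ : Fin j ↪ S) (t : Set (Finset (Fin j) → Finset ℕ → K)) (s : Set (Finset ℕ → K)),
    MeasurableSet t → MeasurableSet s →
    P {ω | properPart φ (profile ω) ∈ t ∧ profile ω (Finset.univ.map φ) ∈ s} =
      ∫⁻ ω in {ω | properPart φ (profile ω) ∈ t},
        volume (G.draw (properPart φ (profile ω)) ⁻¹' s) ∂P

theorem measurable_properPart_profile {S K : Type*} [MeasurableSpace K] [Inhabited K] {j : ℕ}
    (φ : Fin j ↪ S) :
    Measurable fun ω : Finset (S ⊕ ℕ) → K => properPart φ (profile ω) :=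
  (measurable_properPart φ).comp measurable_profile

theorem measurable_profile_apply {S K : Type*} [MeasurableSpace K] (a : Finset S) :
    Measurable fun ω : Finset (S ⊕ ℕ) → K => profile ω a :=
  (measurable_pi_apply a).comp measurable_profile

/-- Permutations of `S` act transitively on injections `Fin j ↪ S`, so a single disintegration for
each `j` serves all listings. -/
theorem exists_sampler_represents {S K : Type*} [Infinite S] [MeasurableSpace K]
    [StandardBorelSpace K] [Inhabited K] (P : Measure (Finset (S ⊕ ℕ) → K))
    [IsProbabilityMeasure P] (hP : IsInjectionInvariant P) :
    ∃ G : SymmetricSampler (Finset ℕ → K), G.Represents P := by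
  let law : ∀ {j : ℕ} (φ : Fin j ↪ S), Measure ((Finset (Fin j) → Finset ℕ → K) × (Finset ℕ → K)) :=
    fun φ => P.map fun ω => (properPart φ (profile ω), profile ω (Finset.univ.map φ))
  have hmeas : ∀ {j : ℕ} (φ : Fin j ↪ S), Measurable fun ω : Finset (S ⊕ ℕ) → K =>
      (properPart φ (profile ω), profile ω (Finset.univ.map φ)) := fun φ =>
    (measurable_properPart_profile φ).prodMk (measurable_profile_apply _)
  have law_eq : ∀ {j : ℕ} (φ ψ : Fin j ↪ S), law φ = law ψ := by
    intro j φ ψ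
    have : MulAction.IsPretransitive (Equiv.Perm S) (Fin j ↪ S) :=
      Equiv.Perm.isMultiplyPretransitive S j
    obtain ⟨g, hg⟩ := MulAction.exists_smul_eq (Equiv.Perm S) φ ψ
    have hg' : φ.trans g.toEmbedding = ψ := by rw [← hg]; rfl
    simp only [law]
    conv_lhs => rw [← hP (g.toEmbedding.sumMap (Function.Embedding.refl ℕ))]
    rw [Measure.map_map (hmeas φ) (measurable_relabel _)]
    congr 1
    funext ω
    simp only [Function.comp_apply, profile_relabel, properPart_relabel, hg', relabel,
      Finset.map_map]
  have law_prob : ∀ {j : ℕ} (φ : Fin j ↪ S), IsProbabilityMeasure (law φ) := fun φ =>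
    Measure.isProbabilityMeasure_map (hmeas φ).aemeasurable
  let φ₀ : ∀ j : ℕ, Fin j ↪ S := fun j => Fin.valEmbedding.trans (Infinite.natEmbedding S)
  have hsymm : ∀ j (σ : Equiv.Perm (Fin j)),
      (law (φ₀ j)).map (Prod.map (relabel σ.toEmbedding) id) = law (φ₀ j) := by
    intro j σ
    -- Relabelling the proper part amounts to permuting the listing, which does not change the full
    -- set in the second entry.
    rw [law_eq (φ₀ j) (σ.toEmbedding.trans (φ₀ j))]
    conv_lhs => rw [← law_eq (φ₀ j) (σ.toEmbedding.trans (φ₀ j))]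
    simp only [law]
    rw [Measure.map_map ((measurable_relabel _).prodMap measurable_id) (hmeas _)]
    congr 1
    funext ω
    simp only [Function.comp_apply, Prod.map_apply, relabel_properPart, id, ← Finset.map_map,
      Finset.map_univ_equiv]
  choose G hG₁ hG₂ hG₃ using fun j => exists_symmetric_draw (law (φ₀ j)) (hsymm j)
  refine ⟨⟨fun {j} => G j, hG₁, fun {j} => hG₂ j⟩, fun j φ t s ht hs => ?_⟩
  have h := hG₃ j t s ht hs
  have hvol : Measurable fun z => (volume (G j z ⁻¹' s) : ENNReal) :=
    measurable_measure_prodMk_left (hG₁ j hs)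
  rw [law_eq (φ₀ j) φ] at h
  simp only [law, Measure.fst] at h
  rw [Measure.map_apply (hmeas φ) (ht.prod hs), Measure.map_map measurable_fst (hmeas φ),
    setLIntegral_map ht hvol (measurable_fst.comp (hmeas φ))] at h
  exact h

/-! ### Conditional independence through the reservoir. -/

/-- An injection which fixes `a` and an initial segment of the reservoir, and moves all other
points into the reservoir. -/
theorem exists_embedding_into_reservoir {S : Type*} [Countable S] (a : Finset S) (N : ℕ) :
    ∃ τ : S ⊕ ℕ ↪ S ⊕ ℕ, (∀ v ∈ a, τ (Sum.inl v) = Sum.inl v) ∧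
      (∀ v ∉ a, ∃ n, τ (Sum.inl v) = Sum.inr n) ∧
      (∀ n < N, τ (Sum.inr n) = Sum.inr n) ∧ ∀ n, ∃ m, τ (Sum.inr n) = Sum.inr m := by
  classical
  obtain ⟨enc, henc⟩ := exists_injective_nat S
  -- Beyond `N`, even offsets receive the points of `S` and odd offsets the reservoir, so the images
  -- are disjoint.
  let f : S ⊕ ℕ → S ⊕ ℕ := Sum.elim
    (fun v => if v ∈ a then Sum.inl v else Sum.inr (N + 2 * enc v))
    (fun n => if n < N then Sum.inr n else Sum.inr (N + 2 * n + 1))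
  have hf : Function.Injective f := by
    rintro (v | n) (w | m) h
    · simp only [f, Sum.elim_inl] at h
      split_ifs at h
      · exact h
      · have h' := Sum.inr.inj h
        rw [henc (show enc v = enc w by omega)]
    · simp only [f, Sum.elim_inl, Sum.elim_inr] at h
      split_ifs at h <;> (have h' := Sum.inr.inj h; omega)
    · simp only [f, Sum.elim_inl, Sum.elim_inr] at h
      split_ifs at h <;> (have h' := Sum.inr.inj h; omega)
    · simp only [f, Sum.elim_inr] at h
      split_ifs at h <;> (have h' := Sum.inr.inj h; exact congrArg Sum.inr (by omega))
  refine ⟨⟨f, hf⟩, fun v hv => ?_, fun v hv => ?_, fun n hn => ?_, fun n => ?_⟩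
  · simp [f, hv]
  · exact ⟨N + 2 * enc v, by simp [f, hv]⟩
  · simp [f, hn]
  · by_cases h : n < N
    · exact ⟨n, by simp [f, h]⟩
    · exact ⟨N + 2 * n + 1, by simp [f, h]⟩

/-- The σ-algebra generated by the profiles of all sets which do not contain `a`. -/
abbrev notAboveAlgebra {S : Type*} (K : Type*) [MeasurableSpace K] (a : Finset S) :
    MeasurableSpace (Finset (S ⊕ ℕ) → K) :=
  MeasurableSpace.comap (fun ω (a' : {a' : Finset S // ¬ a ⊆ a'}) => profile ω a'.1) inferInstance

/-- The σ-algebra generated by the profiles of the proper subsets of the image of `φ`. -/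
abbrev properAlgebra {S : Type*} (K : Type*) [MeasurableSpace K] [Inhabited K] {j : ℕ}
    (φ : Fin j ↪ S) : MeasurableSpace (Finset (S ⊕ ℕ) → K) :=
  MeasurableSpace.comap (fun ω => properPart φ (profile ω)) inferInstance

section

variable {S K : Type*} [MeasurableSpace K]

theorem notAboveAlgebra_le (a : Finset S) : notAboveAlgebra K a ≤ MeasurableSpace.pi := by
  apply Measurable.comap_le
  exact measurable_pi_lambda _ fun _ => measurable_profile_apply _

theorem measurable_profile_notAbove {a a' : Finset S} (h : ¬ a ⊆ a') :
    Measurable[notAboveAlgebra K a] fun ω : Finset (S ⊕ ℕ) → K => profile ω a' :=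
  (measurable_pi_apply (⟨a', h⟩ : {a' : Finset S // ¬ a ⊆ a'})).comp
    (comap_measurable fun (ω : Finset (S ⊕ ℕ) → K) (a' : {a' : Finset S // ¬ a ⊆ a'}) =>
      profile ω a'.1)

theorem measurable_profile_proper [Inhabited K] {j : ℕ} (φ : Fin j ↪ S) {b : Finset (Fin j)}
    (hb : b ≠ Finset.univ) :
    Measurable[properAlgebra K φ] fun ω : Finset (S ⊕ ℕ) → K => profile ω (b.map φ) := by
  have : (fun ω : Finset (S ⊕ ℕ) → K => profile ω (b.map φ)) =
      (fun z : Finset (Fin j) → Finset ℕ → K => z b) ∘ fun ω => properPart φ (profile ω) := by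
    funext ω
    simp [properPart, hb]
  rw [this]
  exact (measurable_pi_apply b).comp (comap_measurable _)

theorem not_univ_map_subset {j : ℕ} (φ : Fin j ↪ S) {b : Finset (Fin j)} (hb : b ≠ Finset.univ) :
    ¬ Finset.univ.map φ ⊆ b.map φ := fun h =>
  hb (Finset.univ_subset_iff.1 (Finset.map_subset_map.1 h))

theorem properAlgebra_le_notAboveAlgebra [Inhabited K] {j : ℕ} (φ : Fin j ↪ S) :
    properAlgebra K φ ≤ notAboveAlgebra K (Finset.univ.map φ) := by
  apply Measurable.comap_le
  refine @measurable_pi_lambda _ _ _ (notAboveAlgebra K (Finset.univ.map φ)) _ _ fun b => ?_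
  by_cases hb : b = Finset.univ
  · simp only [properPart, hb, if_true]
    exact @measurable_const _ _ _ (notAboveAlgebra K (Finset.univ.map φ)) _
  · simp only [properPart, hb, if_false]
    exact measurable_profile_notAbove (not_univ_map_subset φ hb)

/-- If `a'` does not contain `a`, then `τ` maps `a' ∪ c` to `a ∩ a'` plus reservoir points, and `a ∩
a'` is a proper subset of `a`. -/
theorem comap_relabel_notAboveAlgebra_le [Inhabited K] {j : ℕ} (φ : Fin j ↪ S)
    (τ : S ⊕ ℕ ↪ S ⊕ ℕ) (h₁ : ∀ v ∈ Finset.univ.map φ, τ (Sum.inl v) = Sum.inl v)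
    (h₂ : ∀ v ∉ Finset.univ.map φ, ∃ n, τ (Sum.inl v) = Sum.inr n)
    (h₃ : ∀ n, ∃ m, τ (Sum.inr n) = Sum.inr m) :
    (notAboveAlgebra K (Finset.univ.map φ)).comap (relabel τ) ≤ properAlgebra K φ := by
  classical
  rw [MeasurableSpace.comap_comp]
  apply Measurable.comap_le
  refine @measurable_pi_lambda _ _ _ (properAlgebra K φ) _ _ fun a' => ?_
  refine @measurable_pi_lambda _ _ _ (properAlgebra K φ) _ _ fun c => ?_
  let b : Finset (Fin j) := Finset.univ.filter fun i => φ i ∈ a'.1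
  have hb : b ≠ Finset.univ := by
    intro h
    apply a'.2
    intro v hv
    obtain ⟨i, -, rfl⟩ := Finset.mem_map.1 hv
    have : i ∈ b := h ▸ Finset.mem_univ i
    exact (Finset.mem_filter.1 this).2
  let c' : Finset ℕ := ((a'.1.disjSum c).map τ).toRight
  have key : (a'.1.disjSum c).map τ = (b.map φ).disjSum c' := by
    have hleft : ((a'.1.disjSum c).map τ).toLeft = b.map φ := by
      ext v
      simp only [Finset.mem_toLeft, Finset.mem_map, b, Finset.mem_filter, Finset.mem_univ, true_and]
      constructor
      · rintro ⟨w | n, hw, hwv⟩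
        · by_cases hwa : w ∈ Finset.univ.map φ
          · rw [h₁ w hwa] at hwv
            obtain rfl := Sum.inl.inj hwv
            obtain ⟨i, -, rfl⟩ := Finset.mem_map.1 hwa
            exact ⟨i, Finset.inl_mem_disjSum.1 hw, rfl⟩
          · obtain ⟨n, hn⟩ := h₂ w hwa
            rw [hn] at hwv
            cases hwv
        · obtain ⟨m, hm⟩ := h₃ n
          rw [hm] at hwv
          cases hwv
      · rintro ⟨i, hi, rfl⟩
        exact ⟨Sum.inl (φ i), Finset.inl_mem_disjSum.2 hi,
          h₁ _ (Finset.mem_map_of_mem φ (Finset.mem_univ i))⟩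
    rw [← hleft]
    exact (Finset.toLeft_disjSum_toRight).symm
  have hfun : (fun ω : Finset (S ⊕ ℕ) → K => profile (relabel τ ω) a'.1 c) =
      (fun z : Finset ℕ → K => z c') ∘ fun ω => profile ω (b.map φ) := by
    funext ω
    simp [profile, relabel, key]
  change Measurable[properAlgebra K φ] fun ω : Finset (S ⊕ ℕ) → K => profile (relabel τ ω) a'.1 c
  rw [hfun]
  exact (measurable_pi_apply c').comp (measurable_profile_proper φ hb)

variable [Inhabited K] {P : Measure (Finset (S ⊕ ℕ) → K)} [IsProbabilityMeasure P]

/-- The events of `properAlgebra` are exactly the preimages of measurable sets `t`, so `Represents`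
supplies the identity of integrals that characterises the conditional expectation. -/
theorem SymmetricSampler.Represents.condExp_ae_eq {G : SymmetricSampler (Finset ℕ → K)}
    (hG : G.Represents P) {j : ℕ} (φ : Fin j ↪ S) {s : Set (Finset ℕ → K)} (hs : MeasurableSet s) :
    P[((fun ω => profile ω (Finset.univ.map φ)) ⁻¹' s).indicator (fun _ => (1 : ℝ)) |
      properAlgebra K φ] =ᵐ[P]
      fun ω => (volume (G.draw (properPart φ (profile ω)) ⁻¹' s)).toReal := by
  have hle : properAlgebra K φ ≤ MeasurableSpace.pi :=
    (properAlgebra_le_notAboveAlgebra φ).trans (notAboveAlgebra_le _)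
  have hs' := measurable_profile_apply (K := K) (Finset.univ.map φ) hs
  have hvol : Measurable fun ω : Finset (S ⊕ ℕ) → K =>
      (volume (G.draw (properPart φ (profile ω)) ⁻¹' s) : ENNReal) :=
    (G.measurable_volume_draw j hs).comp (measurable_properPart_profile φ)
  have hvol' : Measurable[properAlgebra K φ] fun ω : Finset (S ⊕ ℕ) → K =>
      (volume (G.draw (properPart φ (profile ω)) ⁻¹' s)).toReal :=
    ((G.measurable_volume_draw j hs).comp (comap_measurable _)).ennreal_toReal
  have hint : Integrable (fun ω : Finset (S ⊕ ℕ) → K =>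
      (volume (G.draw (properPart φ (profile ω)) ⁻¹' s)).toReal) P := by
    refine Integrable.of_bound (hvol'.mono hle le_rfl).aestronglyMeasurable 1 ?_
    refine Filter.Eventually.of_forall fun ω => ?_
    rw [Real.norm_of_nonneg ENNReal.toReal_nonneg]
    exact ENNReal.toReal_le_of_le_ofReal zero_le_one (by simpa using prob_le_one)
  refine (ae_eq_condExp_of_forall_setIntegral_eq hle
    ((integrable_const (1 : ℝ)).indicator hs') (fun t _ _ => hint.integrableOn) ?_
    hvol'.stronglyMeasurable.aestronglyMeasurable).symm
  rintro _ ⟨t, ht, rfl⟩ -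
  rw [integral_toReal hvol.aemeasurable (Filter.Eventually.of_forall fun ω => measure_lt_top _ _)]
  have h := hG j φ t s ht hs
  rw [setIntegral_indicator hs', setIntegral_const, smul_eq_mul, mul_one, Measure.real]
  exact congrArg ENNReal.toReal h.symm

/-- The conditional law of the profile of a set `a`, given the profiles of all sets which do not
contain `a`, is drawn by the sampler from the profiles of the proper subsets of `a`. -/
theorem SymmetricSampler.Represents.measure_inter [Countable S]
    {G : SymmetricSampler (Finset ℕ → K)} (hG : G.Represents P) (hP : IsInjectionInvariant P)
    {j : ℕ} (φ : Fin j ↪ S) {t : Set (Finset (S ⊕ ℕ) → K)}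
    (ht : MeasurableSet[notAboveAlgebra K (Finset.univ.map φ)] t) {s : Set (Finset ℕ → K)}
    (hs : MeasurableSet s) :
    P (t ∩ (fun ω => profile ω (Finset.univ.map φ)) ⁻¹' s) =
      ∫⁻ ω in t, volume (G.draw (properPart φ (profile ω)) ⁻¹' s) ∂P := by
  classical
  have ht₀ : MeasurableSet t := notAboveAlgebra_le _ _ ht
  have hprof := measurable_profile_apply (K := K) (Finset.univ.map φ)
  -- A cylinder event involves finitely many companions, all of which one `τ` can fix.
  have cyl : ∀ (I : Finset (Finset ℕ)) (s : Set (I → K)), MeasurableSet s →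
      P (t ∩ (fun ω => profile ω (Finset.univ.map φ)) ⁻¹' (I.restrict ⁻¹' s)) =
      ∫⁻ ω in t, volume (G.draw (properPart φ (profile ω)) ⁻¹' (I.restrict ⁻¹' s)) ∂P := by
    intro I s hs
    have hIs := Finset.measurable_restrict (X := fun _ => K) I hs
    have hs' := hprof hIs
    obtain ⟨τ, h₁, h₂, h₃, h₄⟩ := exists_embedding_into_reservoir (Finset.univ.map φ)
      -- The bound is strict: every reservoir point occurring in `I` lies below it.
      ((I.biUnion id).sup id + 1)
    have hτ : MeasurePreserving (relabel τ) P P := ⟨measurable_relabel τ, hP τ⟩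
    have hfix : ∀ ω : Finset (S ⊕ ℕ) → K, I.restrict (profile (relabel τ ω) (Finset.univ.map φ)) =
        I.restrict (profile ω (Finset.univ.map φ)) := by
      intro ω
      funext c
      simp only [Finset.restrict, profile, relabel]
      congr 1
      conv_rhs => rw [← Finset.map_refl (s := (Finset.univ.map φ).disjSum c.1)]
      rw [Finset.map_eq_image τ, Finset.map_eq_image (Function.Embedding.refl _)]
      refine Finset.image_congr ?_
      rintro (v | n) hv
      · exact h₁ v (Finset.inl_mem_disjSum.1 hv)
      · refine h₃ n (Nat.lt_succ_of_le ?_)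
        exact Finset.le_sup (f := id)
          (Finset.mem_biUnion.2 ⟨c.1, c.2, Finset.inr_mem_disjSum.1 hv⟩)
    have hcond := condExp_eq_of_comap_le (P := P)
      (properAlgebra_le_notAboveAlgebra φ) (notAboveAlgebra_le _) hτ
      (comap_relabel_notAboveAlgebra_le φ τ h₁ h₂ h₄)
      (ξ := ((fun ω => profile ω (Finset.univ.map φ)) ⁻¹' (I.restrict ⁻¹' s)).indicator
        fun _ => (1 : ℝ)) (memLp_indicator_const 2 hs' 1 (Or.inr (measure_ne_top _ _))) (by
          funext ω
          simp only [Function.comp_apply, Set.indicator, Set.mem_preimage, hfix])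
    have hvol : Measurable fun ω : Finset (S ⊕ ℕ) → K =>
        (volume (G.draw (properPart φ (profile ω)) ⁻¹' (I.restrict ⁻¹' s)) : ENNReal) :=
      (G.measurable_volume_draw j hIs).comp (measurable_properPart_profile φ)
    have h₅ := setIntegral_condExp (μ := P) (notAboveAlgebra_le (K := K) (Finset.univ.map φ))
      ((integrable_const (1 : ℝ)).indicator hs') ht
    rw [integral_congr_ae (ae_restrict_of_ae (hcond.trans (hG.condExp_ae_eq φ hIs))),
      setIntegral_indicator hs', setIntegral_const, smul_eq_mul, mul_one, Measure.real] at h₅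
    rw [integral_toReal hvol.aemeasurable
      (Filter.Eventually.of_forall fun ω => measure_lt_top _ _)] at h₅
    refine ((ENNReal.toReal_eq_toReal_iff' ?_ (measure_ne_top _ _)).1 h₅).symm
    refine ((lintegral_mono fun _ => prob_le_one).trans_lt ?_).ne
    simp
  have hdraw : Measurable fun ω : Finset (S ⊕ ℕ) → K =>
      (volume : Measure unitInterval).map (G.draw (properPart φ (profile ω))) := by
    refine Measure.measurable_of_measurable_coe _ fun s hs => ?_
    simp only [Measure.map_apply (G.measurable_draw j).of_uncurry_left hs]
    exact (G.measurable_volume_draw j hs).comp (measurable_properPart_profile (K := K) φ)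
  -- Both sides are measures in `s`, so agreement on cylinders suffices.
  have hmain : (P.restrict t).map (fun ω => profile ω (Finset.univ.map φ)) =
      (P.restrict t).bind fun ω =>
        (volume : Measure unitInterval).map (G.draw (properPart φ (profile ω))) := by
    apply Measure.ext_of_map_finset_restrict
    intro I
    ext s hs
    have hIs := Finset.measurable_restrict (X := fun _ => K) I hs
    rw [Measure.map_apply (Finset.measurable_restrict (X := fun _ => K) I) hs,
      Measure.map_apply (Finset.measurable_restrict (X := fun _ => K) I) hs, Measure.map_apply hprof hIs,
      Measure.restrict_apply (hprof hIs), Measure.bind_apply hIs hdraw.aemeasurable,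
      Set.inter_comm, cyl I s hs]
    simp only [Measure.map_apply (G.measurable_draw j).of_uncurry_left hIs]
  have h := congrArg (fun m => m s) hmain
  simp only [Measure.map_apply hprof hs, Measure.bind_apply hs hdraw.aemeasurable,
    Measure.restrict_apply (hprof hs), Measure.map_apply (G.measurable_draw j).of_uncurry_left hs]
    at h
  rw [Set.inter_comm, h]

end

/-! ### Recursive sampling from independent seeds. -/

/-- A listing of the elements of a finite set. -/
noncomputable def Finset.listing {U : Type*} (a : Finset U) : Fin a.card ↪ U :=
  a.equivFin.symm.toEmbedding.trans (Function.Embedding.subtype _)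

theorem Finset.univ_map_listing {U : Type*} (a : Finset U) :
    Finset.univ.map a.listing = a := by
  ext v
  simp only [Finset.listing, Finset.mem_map, Finset.mem_univ, true_and]
  constructor
  · rintro ⟨i, rfl⟩
    exact (a.equivFin.symm i).2
  · intro hv
    exact ⟨a.equivFin ⟨v, hv⟩, by simp⟩

theorem Finset.card_lt_of_ne_univ {j : ℕ} {b : Finset (Fin j)} (hb : b ≠ Finset.univ) :
    b.card < j := by
  simpa using Finset.card_lt_univ_of_notMem (not_forall.1 (mt Finset.eq_univ_iff_forall.2 hb)).choose_spec

theorem properPart_congr {U V Z : Type*} [Inhabited Z] {j : ℕ} {φ : Fin j ↪ U} {ψ : Fin j ↪ V} {m : Finset U → Z}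
    {m' : Finset V → Z} (h : ∀ b, b ≠ Finset.univ → m (b.map φ) = m' (b.map ψ)) :
    properPart φ m = properPart ψ m' := by
  funext b
  by_cases hb : b = Finset.univ
  · simp [properPart, hb]
  · simp [properPart, hb, h b hb]

namespace SymmetricSampler

variable {U V Z : Type*} [MeasurableSpace Z] [Inhabited Z] (G : SymmetricSampler Z)

/-- The array obtained by running the sampler recursively, with one seed for each finite set. -/
noncomputable def sample (x : Finset U → unitInterval) (a : Finset U) : Z :=
  G.draw (fun b : Finset (Fin a.card) =>
    if _h : b = Finset.univ then default else sample x (b.map a.listing)) (x a)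
termination_by a.card
decreasing_by
  rw [Finset.card_map]
  exact Finset.card_lt_of_ne_univ _h

theorem sample_eq (x : Finset U → unitInterval) (a : Finset U) :
    G.sample x a = G.draw (properPart a.listing (G.sample x)) (x a) := by
  rw [sample]
  simp only [dite_eq_ite]
  rfl

/-- Two listings of one set differ by a permutation, to which `draw` is blind. This frees the
recursion from the choice made in `Finset.listing`. -/
theorem draw_properPart_congr {j j' : ℕ} (φ : Fin j ↪ U) (ψ : Fin j' ↪ U)
    (h : Finset.univ.map φ = Finset.univ.map ψ) (m : Finset U → Z) :
    G.draw (properPart φ m) = G.draw (properPart ψ m) := by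
  obtain rfl : j = j' := by simpa using congrArg Finset.card h
  have hex : ∀ i, ∃ i', φ i' = ψ i := by
    intro i
    have : ψ i ∈ Finset.univ.map φ := h ▸ Finset.mem_map_of_mem ψ (Finset.mem_univ i)
    simpa using this
  choose f hf using hex
  have hinj : Function.Injective f := fun i i' hii' => ψ.injective (by rw [← hf, ← hf, hii'])
  let σ : Equiv.Perm (Fin j) := Equiv.ofBijective f (Finite.injective_iff_bijective.1 hinj)
  have hσ : σ.toEmbedding.trans φ = ψ := by
    ext i
    exact hf i
  rw [← hσ, ← relabel_properPart, G.draw_relabel]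

theorem sample_univ_map {j : ℕ} (φ : Fin j ↪ U) (x : Finset U → unitInterval) :
    G.sample x (Finset.univ.map φ) =
      G.draw (properPart φ (G.sample x)) (x (Finset.univ.map φ)) := by
  rw [sample_eq, G.draw_properPart_congr _ φ (Finset.univ_map_listing _)]

theorem sample_relabel (g : U ↪ V) (x : Finset V → unitInterval) (a : Finset U) :
    G.sample (relabel g x) a = G.sample x (a.map g) := by
  induction hn : a.card using Nat.strong_induction_on generalizing a with
  | _ n ih =>
    have h : a.map g = Finset.univ.map (a.listing.trans g) := by
      rw [← Finset.map_map, Finset.univ_map_listing]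
    rw [sample_eq, h, sample_univ_map, ← h]
    rw [properPart_congr (ψ := a.listing.trans g) (m' := G.sample x)]
    · rfl
    · intro b hb
      rw [← Finset.map_map]
      exact ih _ (hn ▸ (Finset.card_map _).trans_lt (Finset.card_lt_of_ne_univ hb)) _ rfl

theorem sample_congr {x y : Finset U → unitInterval} {a : Finset U}
    (h : ∀ b ⊆ a, x b = y b) : G.sample x a = G.sample y a := by
  induction hn : a.card using Nat.strong_induction_on generalizing a with
  | _ n ih =>
    rw [sample_eq, sample_eq, h a subset_rfl]
    congr 1
    rw [properPart_congr]
    intro b hb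
    have hba : b.map a.listing ⊆ a := by
      conv_rhs => rw [← a.univ_map_listing]
      exact Finset.map_subset_map.2 (Finset.subset_univ b)
    exact ih _ (hn ▸ (Finset.card_map _).trans_lt (Finset.card_lt_of_ne_univ hb))
      (fun c hc => h c (hc.trans hba)) rfl

theorem measurable_sample_apply (a : Finset U) :
    Measurable fun x : Finset U → unitInterval => G.sample x a := by
  induction hn : a.card using Nat.strong_induction_on generalizing a with
  | _ n ih =>
    simp only [G.sample_eq _ a]
    have hpart : Measurable fun x : Finset U → unitInterval =>
        properPart a.listing (G.sample x) := by
      refine measurable_pi_lambda _ fun b => ?_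
      by_cases hb : b = Finset.univ
      · simp only [properPart, hb, if_true]
        exact measurable_const
      · simp only [properPart, hb, if_false]
        exact ih _ (hn ▸ (Finset.card_map _).trans_lt (Finset.card_lt_of_ne_univ hb)) _ rfl
    exact (G.measurable_draw _).comp (hpart.prodMk (measurable_pi_apply a))

theorem measurable_sample : Measurable (G.sample : (Finset U → unitInterval) → Finset U → Z) :=
  measurable_pi_lambda _ G.measurable_sample_apply

end SymmetricSampler

/-! ### The law of the sampled array. -/

/-- Resampling one coordinate preserves a product of probability measures. -/
theorem MeasureTheory.Measure.map_update_prod_pi {ι : Type*} [Fintype ι] [DecidableEq ι]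
    {X : ι → Type*} [∀ i, MeasurableSpace (X i)] (μ : ∀ i, Measure (X i))
    [∀ i, IsProbabilityMeasure (μ i)] (i : ι) :
    ((Measure.pi μ).prod (μ i)).map (fun p => Function.update p.1 i p.2) = Measure.pi μ := by
  refine (Measure.pi_eq fun s hs => ?_).symm
  rw [Measure.map_apply measurable_update' (MeasurableSet.univ_pi hs)]
  have : (fun p : (∀ i, X i) × X i => Function.update p.1 i p.2) ⁻¹' Set.univ.pi s =
      Set.univ.pi (Function.update s i Set.univ) ×ˢ s i := by
    ext ⟨x, u⟩
    simp only [Set.mem_preimage, Set.mem_univ_pi, Set.mem_prod]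
    constructor
    · intro h
      refine ⟨fun k => ?_, by simpa using h i⟩
      by_cases hk : k = i
      · subst hk; simp
      · simpa [hk] using h k
    · rintro ⟨h, hu⟩ k
      by_cases hk : k = i
      · subst hk; simpa using hu
      · simpa [hk] using h k
  rw [this, Measure.prod_prod, Measure.pi_pi, ← Finset.prod_erase_mul _ _ (Finset.mem_univ i),
    ← Finset.prod_erase_mul _ (fun k => μ k (s k)) (Finset.mem_univ i)]
  simp only [Function.update_self, measure_univ, mul_one]
  congr 1
  refine Finset.prod_congr rfl fun k hk => ?_
  rw [Function.update_of_ne (Finset.ne_of_mem_erase hk)]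

/-- The array which agrees with `m` on `D` and is constant elsewhere. -/
def maskTo {U Z : Type*} [DecidableEq U] [Inhabited Z] (D : Finset (Finset U)) (m : Finset U → Z) :
    Finset U → Z :=
  fun a => if a ∈ D then m a else default

section

variable {U Z : Type*} [DecidableEq U] [Inhabited Z]

theorem measurable_maskTo [MeasurableSpace Z] (D : Finset (Finset U)) :
    Measurable (maskTo D : (Finset U → Z) → _) := by
  refine measurable_pi_lambda _ fun b => ?_
  by_cases hb : b ∈ D
  · simp only [maskTo, hb, if_true]
    exact measurable_pi_apply _
  · simp only [maskTo, hb, if_false]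
    exact measurable_const

theorem maskTo_insert (D : Finset (Finset U)) (a : Finset U) (m : Finset U → Z) :
    maskTo (insert a D) m = Function.update (maskTo D m) a (m a) := by
  funext b
  by_cases hb : b = a
  · subst hb; simp [maskTo]
  · simp [maskTo, hb]

theorem properPart_maskTo {D : Finset (Finset U)} {j : ℕ} (φ : Fin j ↪ U)
    (h : ∀ b, b ≠ Finset.univ → b.map φ ∈ D) (m : Finset U → Z) :
    properPart φ (maskTo D m) = properPart φ m :=
  properPart_congr fun b hb => by simp [maskTo, h b hb]

/-- The conditional law of the sampled value at `a` given the values at a family of sets which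
contains the proper subsets of `a` but no superset of `a`. -/
theorem SymmetricSampler.volume_maskTo_inter [Fintype U] [MeasurableSpace Z]
    (G : SymmetricSampler Z)
    {D : Finset (Finset U)} {a : Finset U} (hD : ∀ b ∈ D, ¬ a ⊆ b)
    (hsub : ∀ b : Finset (Fin a.card), b ≠ Finset.univ → b.map a.listing ∈ D)
    {t : Set (Finset U → Z)} (ht : MeasurableSet t) {s : Set Z} (hs : MeasurableSet s) :
    volume ((fun x : Finset U → unitInterval => maskTo D (G.sample x)) ⁻¹' t ∩
      (fun x => G.sample x a) ⁻¹' s) =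
      ∫⁻ m in t, volume (G.draw (properPart a.listing m) ⁻¹' s) ∂
        ((volume : Measure (Finset U → unitInterval)).map fun x => maskTo D (G.sample x)) := by
  have hB : Measurable fun x : Finset U → unitInterval => maskTo D (G.sample x) :=
    (measurable_maskTo D).comp G.measurable_sample
  have hq : Measurable fun m : Finset U → Z =>
      (volume (G.draw (properPart a.listing m) ⁻¹' s) : ENNReal) :=
    (G.measurable_volume_draw _ hs).comp (measurable_properPart _)
  have hE := (hB ht).inter (G.measurable_sample_apply a hs)
  -- The sample at `b` uses only seeds at subsets of `b`, and `a` is not one of them.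
  have hupd : ∀ (x : Finset U → unitInterval) (u : unitInterval) (b : Finset U), ¬ a ⊆ b →
      G.sample (Function.update x a u) b = G.sample x b := fun x u b hb =>
    G.sample_congr fun c hc => by
      rw [Function.update_of_ne]
      rintro rfl
      exact hb hc
  have hmask : ∀ (x : Finset U → unitInterval) (u : unitInterval),
      maskTo D (G.sample (Function.update x a u)) = maskTo D (G.sample x) := by
    intro x u
    funext b
    by_cases hb : b ∈ D
    · simp [maskTo, hb, hupd x u b (hD b hb)]
    · simp [maskTo, hb]
  have hdraw : ∀ (x : Finset U → unitInterval) (u : unitInterval),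
      G.sample (Function.update x a u) a =
        G.draw (properPart a.listing (maskTo D (G.sample x))) u := by
    intro x u
    rw [G.sample_eq, Function.update_self, ← hmask x u, properPart_maskTo _ hsub]
  -- Replacing the seed at `a` by a fresh one keeps the law, leaves the masked array alone and makes
  -- the value at `a` an explicit draw; Fubini then applies.
  have hvol := Measure.map_update_prod_pi (fun _ : Finset U => (volume : Measure unitInterval)) a
  rw [← volume_pi] at hvol
  rw [setLIntegral_map ht hq hB]
  conv_lhs => rw [← hvol]
  rw [Measure.map_apply measurable_update' hE, Measure.prod_apply (measurable_update' hE),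
    ← lintegral_indicator (hB ht)]
  congr 1
  funext x
  by_cases hx : maskTo D (G.sample x) ∈ t
  · rw [Set.indicator_of_mem (show x ∈ (fun x => maskTo D (G.sample x)) ⁻¹' t from hx)]
    congr 1
    ext u
    simp [hmask, hdraw, hx]
  · rw [Set.indicator_of_notMem (show x ∉ (fun x => maskTo D (G.sample x)) ⁻¹' t from hx)]
    convert measure_empty (μ := (volume : Measure unitInterval))
    ext u
    simp [hmask, hx]

/-- The profiles of the subsets of a finite vertex set have the law of the sampled array. -/
theorem SymmetricSampler.Represents.map_maskTo_eq [Fintype U] {S K : Type*} [Countable S]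
    [MeasurableSpace K] [Inhabited K] {P : Measure (Finset (S ⊕ ℕ) → K)} [IsProbabilityMeasure P]
    {G : SymmetricSampler (Finset ℕ → K)} (hG : G.Represents P) (hP : IsInjectionInvariant P)
    (i : U ↪ S) (D : Finset (Finset U)) (hD : ∀ a ∈ D, ∀ b ⊆ a, b ∈ D) :
    P.map (fun ω => maskTo D (relabel i (profile ω))) =
      (volume : Measure (Finset U → unitInterval)).map fun x => maskTo D (G.sample x) := by
  have hA : ∀ D : Finset (Finset U), Measurable fun ω : Finset (S ⊕ ℕ) → K =>
      maskTo D (relabel i (profile ω)) := fun D =>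
    (measurable_maskTo D).comp ((measurable_relabel i).comp measurable_profile)
  have hB : ∀ D : Finset (Finset U), Measurable fun x : Finset U → unitInterval =>
      maskTo D (G.sample x) := fun D => (measurable_maskTo D).comp G.measurable_sample
  revert hD
  -- Adding a set `a` of maximal cardinality leaves `D` closed under subsets, and no member of `D`
  -- contains `a`.
  refine Finset.induction_on_max_value Finset.card D (fun _ => ?_) fun a D ha hmax ih hD => ?_
  · have h₁ : (fun ω : Finset (S ⊕ ℕ) → K => maskTo (∅ : Finset (Finset U))
        (relabel i (profile ω))) = fun _ => default := by
      funext ω b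
      simp [maskTo]
    have h₂ : (fun x : Finset U → unitInterval => maskTo (∅ : Finset (Finset U))
        (G.sample x)) = fun _ => default := by
      funext ω b
      simp [maskTo]
    rw [h₁, h₂, Measure.map_const, Measure.map_const, measure_univ, measure_univ]
  · have hD' : ∀ b ∈ D, ∀ c ⊆ b, c ∈ D := by
      intro b hb c hc
      rcases Finset.mem_insert.1 (hD b (Finset.mem_insert_of_mem hb) c hc) with rfl | h
      · rw [Finset.eq_of_subset_of_card_le hc (hmax b hb)]
        exact hb
      · exact h
    have hnot : ∀ b ∈ D, ¬ a ⊆ b := by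
      intro b hb hab
      rw [Finset.eq_of_subset_of_card_le hab (hmax b hb)] at ha
      exact ha hb
    have hsub : ∀ b : Finset (Fin a.card), b ≠ Finset.univ → b.map a.listing ∈ D := by
      intro b hb
      have hba : b.map a.listing ⊆ a := by
        conv_rhs => rw [← a.univ_map_listing]
        exact Finset.map_subset_map.2 (Finset.subset_univ b)
      refine Finset.mem_of_mem_insert_of_ne (hD a (Finset.mem_insert_self a D) _ hba) ?_
      intro h
      have := congrArg Finset.card h
      rw [Finset.card_map] at this
      exact (Finset.card_lt_of_ne_univ hb).ne this
    have hmap : Finset.univ.map (a.listing.trans i) = a.map i := by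
      rw [← Finset.map_map, Finset.univ_map_listing]
    have hpair : P.map (fun ω => (maskTo D (relabel i (profile ω)), profile ω (a.map i))) =
        (volume : Measure (Finset U → unitInterval)).map
          fun x => (maskTo D (G.sample x), G.sample x a) := by
      have hA' := (hA D).prodMk (measurable_profile_apply (K := K) (a.map i))
      have hB' := (hB D).prodMk (G.measurable_sample_apply a)
      have : IsFiniteMeasure
          (P.map fun ω => (maskTo D (relabel i (profile ω)), profile ω (a.map i))) :=
        inferInstance
      refine Measure.ext_prod fun {t s} ht hs => ?_
      rw [Measure.map_apply hA' (ht.prod hs), Measure.map_apply hB' (ht.prod hs)]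
      refine Eq.trans ?_ (G.volume_maskTo_inter hnot hsub ht hs).symm
      have hmeas : MeasurableSet[notAboveAlgebra K (Finset.univ.map (a.listing.trans i))]
          ((fun ω : Finset (S ⊕ ℕ) → K => maskTo D (relabel i (profile ω))) ⁻¹' t) := by
        rw [hmap]
        refine @measurable_pi_lambda _ _ _ (notAboveAlgebra K (a.map i)) _ _ (fun b => ?_) t ht
        by_cases hb : b ∈ D
        · simp only [maskTo, hb, if_true]
          exact measurable_profile_notAbove fun h => hnot b hb (Finset.map_subset_map.1 h)
        · simp only [maskTo, hb, if_false]
          exact @measurable_const _ _ _ (notAboveAlgebra K (a.map i)) _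
      have h := hG.measure_inter hP (a.listing.trans i) hmeas hs
      rw [hmap] at h
      refine h.trans ?_
      have hq : Measurable fun m : Finset U → Finset ℕ → K =>
          (volume (G.draw (properPart a.listing m) ⁻¹' s) : ENNReal) :=
        (G.measurable_volume_draw _ hs).comp (measurable_properPart _)
      rw [← ih hD', setLIntegral_map ht hq (hA D)]
      congr 1
      funext ω
      rw [properPart_maskTo _ hsub, properPart_relabel]
    have hupd : Measurable fun p : (Finset U → Finset ℕ → K) × (Finset ℕ → K) =>
        Function.update p.1 a p.2 := measurable_update'
    have h := congrArg (Measure.map fun p : (Finset U → Finset ℕ → K) × (Finset ℕ → K) =>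
      Function.update p.1 a p.2) hpair
    rw [Measure.map_map hupd ((hA D).prodMk (measurable_profile_apply _)),
      Measure.map_map hupd ((hB D).prodMk (G.measurable_sample_apply a))] at h
    simp only [maskTo_insert]
    exact h

end

/-! ### Hypergraphs as arrays, and edge probabilities. -/

/-- The array indexed by all finite sets which agrees with a coloured hypergraph on its edges and
is constant elsewhere. -/
def extendColours {K T : Type*} [Inhabited K] {k : ℕ} (ω : ColouredHypergraph K T k) :
    Finset T → K :=
  fun e => if h : e.card = k then ω ⟨e, h⟩ else default

theorem measurable_extendColours {K T : Type*} [MeasurableSpace K] [Inhabited K] {k : ℕ} :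
    Measurable (extendColours : ColouredHypergraph K T k → Finset T → K) := by
  refine measurable_pi_lambda _ fun e => ?_
  by_cases h : e.card = k
  · simp only [extendColours, h, dite_true]
    exact measurable_pi_apply _
  · simp only [extendColours, h, dite_false]
    exact measurable_const

theorem relabel_extendColours {K S T : Type*} [Inhabited K] {k : ℕ} (g : S ↪ T)
    (ω : ColouredHypergraph K T k) :
    relabel g (extendColours ω) = extendColours fun e : HyperEdge S k => ω (e.image g) := by
  funext e
  simp only [relabel, extendColours, Finset.card_map]
  rfl

theorem HyperEdge.image_image {S T U : Type*} {k : ℕ} (f : S ↪ T) (g : T ↪ U)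
    (e : HyperEdge S k) : (e.image f).image g = e.image (f.trans g) :=
  Subtype.ext (Finset.map_map f g e.1)

theorem HyperEdge.univ_map_listing {S : Type*} {k : ℕ} (e : HyperEdge S k) (φ : Fin k ≃ e.1) :
    Finset.univ.map (e.listing φ) = e.1 := by
  ext v
  simp only [HyperEdge.listing, Finset.mem_map, Finset.mem_univ, true_and]
  constructor
  · rintro ⟨i, rfl⟩
    exact (φ i).2
  · intro hv
    exact ⟨φ.symm ⟨v, hv⟩, by simp⟩

/-- An exchangeable hypergraph on `S`, transported along `S ⊕ ℕ ≃ S`, is invariant under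
injections. -/
theorem IsExchangeableLaw.isInjectionInvariant {K S T : Type*} [MeasurableSpace K] [Inhabited K]
    {k : ℕ} {μ : Measure (ColouredHypergraph K S k)} [IsFiniteMeasure μ]
    (hμ : IsExchangeableLaw μ) (ι : T ≃ S) :
    IsInjectionInvariant (μ.map fun ω =>
      extendColours fun e : HyperEdge T k => ω (e.image ι.toEmbedding)) := by
  intro g
  have h₁ : Measurable fun ω : ColouredHypergraph K S k =>
      extendColours fun e : HyperEdge T k => ω (e.image ι.toEmbedding) :=
    measurable_extendColours.comp (measurable_image_pullback ι.toEmbedding)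
  let g' : S ↪ S := ι.symm.toEmbedding.trans (g.trans ι.toEmbedding)
  rw [Measure.map_map (measurable_relabel g) h₁]
  conv_rhs => rw [← hμ.map_embedding g']
  rw [Measure.map_map h₁ (measurable_image_pullback g')]
  congr 1
  funext ω
  simp only [Function.comp_apply, relabel_extendColours, HyperEdge.image_image]
  congr 1
  funext e
  congr 2
  ext x
  simp [g']

/-- The extension by zero of a family of seeds. -/
def extendSeeds {U : Type*} {k : ℕ} (x : LowerEdge U k → unitInterval) :
    Finset U → unitInterval :=
  fun a => if h : a.card < k then x ⟨a, h⟩ else 0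

theorem measurable_extendSeeds {U : Type*} {k : ℕ} :
    Measurable (extendSeeds : (LowerEdge U k → unitInterval) → _) := by
  refine measurable_pi_lambda _ fun a => ?_
  by_cases h : a.card < k
  · simp only [extendSeeds, h, dite_true]
    exact measurable_pi_apply _
  · simp only [extendSeeds, h, dite_false]
    exact measurable_const

theorem extendSeeds_pullbackLower {U V : Type*} {k : ℕ} (f : U ↪ V)
    (x : LowerEdge V k → unitInterval) :
    extendSeeds (pullbackLower f x) = relabel f (extendSeeds x) := by
  funext a
  simp only [relabel, extendSeeds, Finset.card_map]
  rfl

namespace SymmetricSampler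

variable {Z : Type*} [MeasurableSpace Z] [Inhabited Z] (G : SymmetricSampler Z)

/-- The probability that the value drawn at a `k`-set belongs to `s`, as a function of the seeds at
its proper subsets. -/
noncomputable def edgeProb {k : ℕ} (s : Set Z) (y : LowerEdge (Fin k) k → unitInterval) :
    unitInterval :=
  ⟨(volume : Measure unitInterval).real
    (G.draw (properPart (Function.Embedding.refl _) (G.sample (extendSeeds y))) ⁻¹' s),
    measureReal_nonneg, measureReal_le_one⟩

theorem measurable_edgeProb {k : ℕ} {s : Set Z} (hs : MeasurableSet s) :
    Measurable (G.edgeProb (k := k) s) :=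
  Measurable.subtype_mk (((G.measurable_volume_draw k hs).comp ((measurable_properPart _).comp
    (G.measurable_sample.comp measurable_extendSeeds))).ennreal_toReal)

theorem edgeProb_pullbackLower {U : Type*} {k : ℕ} (s : Set Z) (f : Fin k ↪ U)
    (x : LowerEdge U k → unitInterval) :
    (G.edgeProb s (pullbackLower f x) : ℝ) =
      (volume : Measure unitInterval).real
        (G.draw (properPart f (G.sample (extendSeeds x))) ⁻¹' s) := by
  simp only [edgeProb, extendSeeds_pullbackLower]
  rw [properPart_congr (ψ := f) (m' := G.sample (extendSeeds x))]
  intro b _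
  rw [G.sample_relabel, Finset.map_refl]

theorem edgeProb_perm {k : ℕ} (s : Set Z) (σ : Equiv.Perm (Fin k))
    (y : LowerEdge (Fin k) k → unitInterval) :
    G.edgeProb s (pullbackLower σ.toEmbedding y) = G.edgeProb s y := by
  apply Subtype.ext
  rw [edgeProb_pullbackLower]
  change _ = (volume : Measure unitInterval).real _
  rw [← G.draw_relabel σ (properPart (Function.Embedding.refl _) _), relabel_properPart]
  rfl

/-- The probability that the sampled values at the edges of a hypergraph all lie in `s`. -/
theorem volume_forall_sample_mem {U : Type*} [Fintype U] {k : ℕ} {s : Set Z}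
    (hs : MeasurableSet s) (F : Finset (HyperEdge U k)) (φ : ∀ e : HyperEdge U k, Fin k ≃ e.1) :
    (volume : Measure (Finset U → unitInterval)).real {x | ∀ e ∈ F, G.sample x e.1 ∈ s} =
      ∫ x : LowerEdge U k → unitInterval,
        ∏ e ∈ F, (G.edgeProb s (pullbackLower (e.listing (φ e)) x) : ℝ) := by
  classical
  let A : (LowerEdge U k → unitInterval) → HyperEdge U k → Set unitInterval := fun x e =>
    G.draw (properPart (e.listing (φ e)) (G.sample (extendSeeds x))) ⁻¹' s
  have hA : ∀ e, Measurable fun x => (volume (A x e) : ENNReal) := fun e =>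
    (G.measurable_volume_draw k hs).comp ((measurable_properPart _).comp
      (G.measurable_sample.comp measurable_extendSeeds))
  have hE : MeasurableSet {x : Finset U → unitInterval | ∀ e ∈ F, G.sample x e.1 ∈ s} := by
    have : {x : Finset U → unitInterval | ∀ e ∈ F, G.sample x e.1 ∈ s} =
        ⋂ e ∈ F, (fun x => G.sample x e.1) ⁻¹' s := by
      ext x
      simp
    rw [this]
    exact Finset.measurableSet_biInter F fun e _ => G.measurable_sample_apply _ hs
  let upper : HyperEdge U k ↪ {a : Finset U // ¬ a.card < k} :=
    ⟨fun e => ⟨e.1, e.2.not_lt⟩, fun e e' h => Subtype.ext (congrArg (fun a => a.1) h)⟩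
  have hupper : ∀ e, upper e = ⟨e.1, e.2.not_lt⟩ := fun _ => rfl
  have hpres := (volume_preserving_piEquivPiSubtypeProd (fun _ : Finset U => unitInterval)
    fun a => a.card < k).symm
  have hsample : ∀ (x : LowerEdge U k → unitInterval)
      (y : {a : Finset U // ¬ a.card < k} → unitInterval) (e : HyperEdge U k),
      G.sample ((MeasurableEquiv.piEquivPiSubtypeProd (fun _ : Finset U => unitInterval)
        fun a => a.card < k).symm (x, y)) e.1 ∈ s ↔ y (upper e) ∈ A x e := by
    intro x y e
    have h₁ : ∀ a : Finset U, a.card < k →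
        (MeasurableEquiv.piEquivPiSubtypeProd (fun _ : Finset U => unitInterval)
          fun a => a.card < k).symm (x, y) a = extendSeeds x a := by
      intro a ha
      simp [MeasurableEquiv.piEquivPiSubtypeProd, Equiv.piEquivPiSubtypeProd, extendSeeds, ha]
    have h₂ : (MeasurableEquiv.piEquivPiSubtypeProd (fun _ : Finset U => unitInterval)
          fun a => a.card < k).symm (x, y) e.1 = y (upper e) := by
      simp [MeasurableEquiv.piEquivPiSubtypeProd, Equiv.piEquivPiSubtypeProd, e.2, hupper]
    have h₃ := G.sample_univ_map (e.listing (φ e))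
      ((MeasurableEquiv.piEquivPiSubtypeProd (fun _ : Finset U => unitInterval)
        fun a => a.card < k).symm (x, y))
    rw [e.univ_map_listing, h₂, properPart_congr (ψ := e.listing (φ e))
      (m' := G.sample (extendSeeds x)) fun b hb => G.sample_congr fun c hc => h₁ c
        ((Finset.card_le_card hc).trans_lt
          ((Finset.card_map _).trans_lt (Finset.card_lt_of_ne_univ hb)))] at h₃
    rw [h₃]
    rfl
  -- With the lower seeds frozen, distinct edges depend on distinct independent seeds; seeds at
  -- larger sets are unconstrained.
  have hfib : ∀ x : LowerEdge U k → unitInterval,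
      volume {y : {a : Finset U // ¬ a.card < k} → unitInterval |
        ∀ e ∈ F, y (upper e) ∈ A x e} = ∏ e ∈ F, volume (A x e) := by
    intro x
    let B : {a : Finset U // ¬ a.card < k} → Set unitInterval := fun a =>
      if h : a.1.card = k then A x ⟨a.1, h⟩ else Set.univ
    have hB : ∀ e, B (upper e) = A x e := fun e => dif_pos e.2
    have hBm : ∀ a, MeasurableSet (B a) := by
      intro a
      by_cases h : a.1.card = k
      · simp only [B, h, dite_true]
        exact (G.measurable_draw k).of_uncurry_left hs
      · simp [B, h]
    have : {y : {a : Finset U // ¬ a.card < k} → unitInterval |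
        ∀ e ∈ F, y (upper e) ∈ A x e} = Set.pi (F.map upper) B := by
      ext y
      simp only [Set.mem_ofPred_eq, Set.mem_pi, Finset.mem_coe, Finset.mem_map]
      constructor
      · rintro h _ ⟨e, he, rfl⟩
        rw [hB]
        exact h e he
      · intro h e he
        rw [← hB]
        exact h _ ⟨e, he, rfl⟩
    rw [this, volume_pi, ← Measure.infinitePi_eq_pi, Measure.infinitePi_pi _ fun a _ => hBm a,
      Finset.prod_map]
    simp only [hB]
  have hvol : volume {x : Finset U → unitInterval | ∀ e ∈ F, G.sample x e.1 ∈ s} =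
      ∫⁻ x : LowerEdge U k → unitInterval, ∏ e ∈ F, volume (A x e) := by
    rw [← hpres.measure_preimage hE.nullMeasurableSet, Measure.volume_eq_prod,
      Measure.prod_apply (hpres.measurable hE)]
    congr 1
    funext x
    rw [← hfib x]
    congr 1
    ext y
    simp only [Set.mem_preimage, Set.mem_ofPred_eq]
    exact forall₂_congr fun e _ => hsample x y e
  rw [Measure.real, hvol, ← integral_toReal (Finset.measurable_prod _ fun e _ => hA e).aemeasurable
    (Filter.Eventually.of_forall fun x => ENNReal.prod_lt_top fun e _ => measure_lt_top _ _)]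
  congr 1
  funext x
  rw [ENNReal.toReal_prod]
  exact Finset.prod_congr rfl fun e _ => (G.edgeProb_pullbackLower s _ x).symm

end SymmetricSampler

/-! ### The representation theorem. -/

theorem theorem4p1 {S : Type*} [Countable S] [Infinite S] (k : ℕ)
    (μ : Measure (ColouredHypergraph (Fin 2) S k)) [IsProbabilityMeasure μ]
    (hμ : IsExchangeableLaw μ) :
    ∃ W : (LowerEdge (Fin k) k → unitInterval) → unitInterval,
      Measurable W ∧
      (∀ (σ : Equiv.Perm (Fin k)) (y : LowerEdge (Fin k) k → unitInterval),
        W (pullbackLower σ.toEmbedding y) = W y) ∧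
      ∀ (V : Finset S) (F : Finset (HyperEdge V k)) (φ : ∀ e : HyperEdge V k, Fin k ≃ e.1),
        μ.real (containsHypergraph V F) =
          ∫ x : LowerEdge V k → unitInterval,
            ∏ e ∈ F, (W (pullbackLower (e.listing (φ e)) x) : ℝ) := by
  classical
  obtain ⟨ι⟩ := nonempty_equiv_of_countable (α := S ⊕ ℕ) (β := S)
  let ext : ColouredHypergraph (Fin 2) S k → Finset (S ⊕ ℕ) → Fin 2 := fun ω =>
    extendColours fun e : HyperEdge (S ⊕ ℕ) k => ω (e.image ι.toEmbedding)
  have hext : Measurable ext :=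
    measurable_extendColours.comp (measurable_image_pullback ι.toEmbedding)
  let P := μ.map ext
  have hP : IsInjectionInvariant P := hμ.isInjectionInvariant ι
  have : IsProbabilityMeasure P := Measure.isProbabilityMeasure_map hext.aemeasurable
  obtain ⟨G, hG⟩ := exists_sampler_represents P hP
  -- With no companions, the profile of an edge is its own colour.
  let s : Set (Finset ℕ → Fin 2) := {z | z ∅ = 1}
  have hs : MeasurableSet s := measurable_pi_apply (∅ : Finset ℕ) (measurableSet_singleton 1)
  refine ⟨G.edgeProb s, G.measurable_edgeProb hs, G.edgeProb_perm s, fun V F φ => ?_⟩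
  rw [← G.volume_forall_sample_mem hs F φ, Measure.real, Measure.real]
  congr 1
  have hcyl : MeasurableSet {m : Finset V → Finset ℕ → Fin 2 | ∀ e ∈ F, m e.1 ∈ s} := by
    have : {m : Finset V → Finset ℕ → Fin 2 | ∀ e ∈ F, m e.1 ∈ s} =
        ⋂ e ∈ F, (fun m => m e.1) ⁻¹' s := by
      ext m
      simp
    rw [this]
    exact Finset.measurableSet_biInter F fun e _ => measurable_pi_apply _ hs
  have hcont : MeasurableSet (containsHypergraph V F) := by
    have : containsHypergraph V F = ⋂ e ∈ F, (fun ω : ColouredHypergraph (Fin 2) S k =>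
        ω (e.image (Function.Embedding.subtype _))) ⁻¹' {1} := by
      ext ω
      simp [containsHypergraph]
    rw [this]
    exact Finset.measurableSet_biInter F fun e _ =>
      measurable_pi_apply _ (measurableSet_singleton _)
  let incl : V ↪ S := Function.Embedding.subtype _
  have hlaw := hG.map_maskTo_eq hP incl Finset.univ fun _ _ _ _ => Finset.mem_univ _
  have hmask : ∀ m : Finset V → Finset ℕ → Fin 2, maskTo Finset.univ m = m := fun m => by
    funext a
    simp [maskTo]
  simp only [hmask] at hlaw
  have h := congrArg (fun ν => ν {m : Finset V → Finset ℕ → Fin 2 | ∀ e ∈ F, m e.1 ∈ s}) hlaw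
  have hprof : Measurable fun ω : Finset (S ⊕ ℕ) → Fin 2 => relabel incl (profile ω) :=
    (measurable_relabel incl).comp measurable_profile
  simp only [Measure.map_apply hprof hcyl, Measure.map_apply G.measurable_sample hcyl] at h
  refine Eq.trans ?_ h
  rw [Measure.map_apply hext (hprof hcyl)]
  -- Under `P` the vertices of `V` sit at their images under `ι ∘ inl`; invariance under this
  -- self-injection of `S` moves the event there.
  conv_lhs => rw [← hμ.map_embedding (Function.Embedding.inl.trans ι.toEmbedding)]
  rw [Measure.map_apply (measurable_image_pullback _) hcont]
  congr 1
  ext ω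
  simp only [containsHypergraph, Set.mem_preimage, Set.mem_ofPred_eq, s]
  refine forall₂_congr fun e _ => ?_
  have hcard : (e.1.map incl).card = k := (Finset.card_map _).trans e.2
  have : relabel incl (profile (ext ω)) e.1 ∅ = ω ((e.image (Function.Embedding.subtype _)).image
      (Function.Embedding.inl.trans ι.toEmbedding)) := by
    simp only [relabel, profile, ext, extendColours, Finset.disjSum_empty, Finset.card_map, e.2,
      dite_true]
    congr 1
    apply Subtype.ext
    simp only [HyperEdge.image, Finset.map_map]
    rfl
  rw [this]
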